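/- Consider a controlled Markov chain with state space $\mathbb X=\mathbb R^n$, action space $\mathbb U$ a compact metrizable space (every action being admissible in every state), transition kernel $\mathcal T(dy\mid x,u)$ from $\mathbb X\times\mathbb U$ to $\mathbb X$, and bounded measurable one-stage cost $c:\mathbb X\times\mathbb U\to\mathbb R$. A (randomized) stationary policy is a stochastic kernel $\gamma(du\mid x)$ from $\mathbb X$ to $\mathbb U$; it is deterministic if $\gamma(\cdot\mid x)=\delta_{f(x)}$ for a measurable $f:\mathbb X\to\mathbb U$. Put $\mathcal T^\gamma(A\mid x)=\int \mathcal T(A\mid x,u)\,\gamma(du\mid x)$ and $P^\gamma(\pi)=\int\pi(dx)\,\mathcal T^\gamma(\cdot\mid x)$. Let $$J(x,\gamma)=\limsup_{N\to\infty}\frac1N\,E^\gamma_x\Big[\sum_{t=0}^{N-1}c(X_t,U_t)\Big]$$ be the average cost, where $E^\gamma_x$ is the expectation for the state-action process started at $X_0=x$ under $\gamma$. Suppose that: (i) the set of invariant occupation measures $\mathcal G=\{\mu\in\mathcal P(\mathbb X\times\mathbb U):\mu(B\times\mathbb U)=\int \mathcal T(B\mid x,u)\,\mu(dx,du)\ \text{for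 all Borel } B\}$ is compact in the topology of weak convergence; (ii) there is $\alpha\in[0,1)$ such that for every stationary policy $\gamma$ and all probability measures $\pi,\bar\pi$ on $\mathbb X$, $\|P^\gamma(\pi)-P^\gamma(\bar\pi)\|_{TV}\le\alpha\|\pi-\bar\pi\|_{TV}$; (iii) there is a measure $\psi$ on $\mathbb R^n$ that gives no mass to points (for example Lebesgue measure, $n\ge1$) such that each $\mathcal T(\cdot\mid x,u)$ has a density $f_{x,u}\ge 0$ with respect to $\psi$, each $f_{x,u}$ is bounded, and the family $\{f_{x,u}\}_{(x,u)\in\mathbb X\times\mathbb U}$ is equicontinuous; (iv) either $(x,u)\mapsto\int g(y)\,\mathcal T(dy\mid x,u)$ is continuous for every bounded continuous $g$ and $c$ is continuous; or, for every $x$, $u\mapsto\int g(y)\,\mathcal T(dy\mid x,u)$ is continuous for every bounded measurable $g$ and $u\mapsto c(x,u)$ is continuous. Then every stationary policy has a unique invariant probability measure, and for every stationary policy $\gamma$ and every $\varepsilon>0$ there is a deterministic stationary policy $f$ with $|J(x,f)-J(x,\gamma)|<\varepsilon$ for all $x\in\mathbb X$. -/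

import Mathlib

open MeasureTheory ProbabilityTheory Filter

namespace ControlledChain

/-! Controlled Markov chains with state space `X`, action space `U` (every action is admissible in
every state), transition kernel `T : Kernel (X × U) X`, and running cost `c : X × U → ℝ`.
A (randomized) stationary policy is a Markov kernel `γ : Kernel X U`; it is deterministic when it is
`Kernel.deterministic f hf` for a measurable `f : X → U`. -/

section General

variable {X U : Type*} [MeasurableSpace X] [MeasurableSpace U]

/-- The transition kernel of the state process under the stationary policy `γ`:
`A ↦ ∫ T(A | x, u) γ(du | x)`. -/
noncomputable def stateKernel (T : Kernel (X × U) X) (γ : Kernel X U) : Kernel X X :=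
  T ∘ₖ (Kernel.id ×ₖ γ)

/-- The transition kernel of the state-action process under the stationary policy `γ`: from `(x, u)`
the next state `x'` has law `T(· | x, u)` and the next action has law `γ(· | x')`. -/
noncomputable def stateActionKernel (T : Kernel (X × U) X) (γ : Kernel X U) :
    Kernel (X × U) (X × U) :=
  T ⊗ₖ Kernel.prodMkLeft (X × U) γ

instance (T : Kernel (X × U) X) (γ : Kernel X U) [IsMarkovKernel T] [IsMarkovKernel γ] :
    IsMarkovKernel (stateActionKernel T γ) := by
  unfold stateActionKernel; infer_instance

/-- The strategic measure on the space of all state-action trajectories (Ionescu-Tulcea), for the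
stationary policy `γ` and the initial state `x`: `X₀ = x`, `Uₜ ∼ γ(· | Xₜ)` given the past, and
`Xₜ₊₁ ∼ T(· | Xₜ, Uₜ)` given the past. -/
noncomputable def pathMeasure (T : Kernel (X × U) X) (γ : Kernel X U)
    [IsMarkovKernel T] [IsMarkovKernel γ] (x : X) : Measure (ℕ → X × U) :=
  Kernel.trajMeasure (X := fun _ : ℕ => X × U) (Measure.dirac x ⊗ₘ γ)
    (fun t => (stateActionKernel T γ).comap
      (fun h : (i : Finset.Iic t) → X × U => h ⟨t, Finset.mem_Iic.2 le_rfl⟩)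
      (measurable_pi_apply _))

/-- The long-run average cost `limsup_N (1/N) E_x^γ [∑_{t<N} c(Xₜ, Uₜ)]`. -/
noncomputable def avgCost (T : Kernel (X × U) X) (c : X × U → ℝ) (γ : Kernel X U)
    [IsMarkovKernel T] [IsMarkovKernel γ] (x : X) : ℝ :=
  limsup (fun N : ℕ =>
    (1 / (N : ℝ)) * ∫ ω, ∑ t ∈ Finset.range N, c (ω t) ∂(pathMeasure T γ x)) atTop

/-- The set of invariant occupation measures: probability measures `μ` on state-action pairs with
`μ(B × U) = ∫ T(B | x, u) μ(dx, du)` for all measurable `B`. -/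
def invariantOccupation (T : Kernel (X × U) X) : Set (ProbabilityMeasure (X × U)) :=
  {μ | ∀ B : Set X, MeasurableSet B →
    (μ : Measure (X × U)) (B ×ˢ Set.univ) = ∫⁻ z, T z B ∂(μ : Measure (X × U))}

/-- The total variation norm `‖μ - ν‖_TV = 2 sup_A |μ(A) - ν(A)|` of the difference of two
probability measures. -/
noncomputable def tvDist (μ ν : Measure X) : ℝ :=
  2 * ⨆ A : {A : Set X // MeasurableSet A}, |μ.real A - ν.real A|

/-- The state kernel of every stationary policy contracts total variation by the factor `α`. -/
def TVContraction (T : Kernel (X × U) X) (α : ℝ) : Prop :=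
  ∀ γ : Kernel X U, IsMarkovKernel γ →
    ∀ π π' : Measure X, IsProbabilityMeasure π → IsProbabilityMeasure π' →
      tvDist (π.bind (stateKernel T γ)) (π'.bind (stateKernel T γ)) ≤ α * tvDist π π'

end General

section Topological

variable {X U : Type*} [TopologicalSpace X] [MeasurableSpace X]
  [TopologicalSpace U] [MeasurableSpace U]

/-- Weak continuity of the transition kernel, jointly in the state and the action. -/
def WeaklyContinuous (T : Kernel (X × U) X) : Prop :=
  ∀ g : X → ℝ, Continuous g → (∃ C, ∀ y, |g y| ≤ C) → Continuous fun z => ∫ y, g y ∂(T z)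

/-- Strong (setwise) continuity of the transition kernel in the action, for every fixed state. -/
def StronglyContinuousInAction (T : Kernel (X × U) X) : Prop :=
  ∀ g : X → ℝ, Measurable g → (∃ C, ∀ y, |g y| ≤ C) →
    ∀ x, Continuous fun u => ∫ y, g y ∂(T (x, u))

/-- The measures `T(· | x, u)` have densities with respect to `ψ` which are bounded, and which form
an equicontinuous family, indexed by the pairs `(x, u)`. -/
def HasEquicontinuousDensities (T : Kernel (X × U) X) (ψ : Measure X) : Prop :=
  ∃ f : X × U → X → ℝ,
    (∀ z y, 0 ≤ f z y) ∧
    (∀ z, T z = ψ.withDensity fun y => ENNReal.ofReal (f z y)) ∧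
    (∀ z, ∃ C, ∀ y, f z y ≤ C) ∧
    Equicontinuous f

end Topological

end ControlledChain

namespace ControlledChain

open Topology Set

section TotalVariation

variable {X : Type*} [MeasurableSpace X]

theorem abs_real_sub_real_le_one (μ ν : Measure X) [IsProbabilityMeasure μ]
    [IsProbabilityMeasure ν] (A : Set X) : |μ.real A - ν.real A| ≤ 1 := by
  have h1 := measureReal_le_one (μ := μ) (s := A)
  have h2 := measureReal_le_one (μ := ν) (s := A)
  have h3 := measureReal_nonneg (μ := μ) (s := A)
  have h4 := measureReal_nonneg (μ := ν) (s := A)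
  exact abs_sub_le_iff.2 ⟨by linarith, by linarith⟩

theorem abs_real_sub_real_le_tvDist (μ ν : Measure X) [IsProbabilityMeasure μ]
    [IsProbabilityMeasure ν] {A : Set X} (hA : MeasurableSet A) :
    |μ.real A - ν.real A| ≤ tvDist μ ν / 2 := by
  have hb : BddAbove (range fun A : {A : Set X // MeasurableSet A} => |μ.real A - ν.real A|) :=
    ⟨1, by rintro _ ⟨B, rfl⟩; exact abs_real_sub_real_le_one μ ν B⟩
  have := le_ciSup hb ⟨A, hA⟩
  unfold tvDist
  linarith

theorem tvDist_le_of_forall {μ ν : Measure X} {r : ℝ}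
    (h : ∀ A, MeasurableSet A → |μ.real A - ν.real A| ≤ r) : tvDist μ ν ≤ 2 * r := by
  have : Nonempty {A : Set X // MeasurableSet A} := ⟨⟨∅, .empty⟩⟩
  exact mul_le_mul_of_nonneg_left (ciSup_le fun A => h A A.2) zero_le_two

theorem tvDist_comm (μ ν : Measure X) : tvDist μ ν = tvDist ν μ := by
  simp only [tvDist, abs_sub_comm]

theorem tvDist_nonneg (μ ν : Measure X) : 0 ≤ tvDist μ ν :=
  mul_nonneg zero_le_two (Real.iSup_nonneg fun _ => abs_nonneg _)

theorem tvDist_le_two (μ ν : Measure X) [IsProbabilityMeasure μ] [IsProbabilityMeasure ν] :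
    tvDist μ ν ≤ 2 := by
  simpa using tvDist_le_of_forall fun A _ => abs_real_sub_real_le_one μ ν A

theorem tvDist_triangle (μ ν ρ : Measure X) [IsProbabilityMeasure μ] [IsProbabilityMeasure ν]
    [IsProbabilityMeasure ρ] : tvDist μ ρ ≤ tvDist μ ν + tvDist ν ρ := by
  have := tvDist_le_of_forall (μ := μ) (ν := ρ) (r := (tvDist μ ν + tvDist ν ρ) / 2) fun A hA => by
    have h1 := abs_real_sub_real_le_tvDist μ ν hA
    have h2 := abs_real_sub_real_le_tvDist ν ρ hA
    have h3 := abs_sub_le (μ.real A) (ν.real A) (ρ.real A)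
    linarith
  linarith

theorem eq_of_tvDist_nonpos {μ ν : Measure X} [IsProbabilityMeasure μ] [IsProbabilityMeasure ν]
    (h : tvDist μ ν ≤ 0) : μ = ν := by
  ext A hA
  have h1 := abs_real_sub_real_le_tvDist μ ν hA
  have h2 : |μ.real A - ν.real A| = 0 := le_antisymm (by linarith) (abs_nonneg _)
  rw [abs_eq_zero, sub_eq_zero, measureReal_def, measureReal_def] at h2
  exact (ENNReal.toReal_eq_toReal_iff' (measure_ne_top _ _) (measure_ne_top _ _)).1 h2

/-- Bounded functions integrate Lipschitz-continuously with respect to total variation. -/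
theorem abs_integral_sub_integral_le_tvDist (μ ν : Measure X) [IsProbabilityMeasure μ]
    [IsProbabilityMeasure ν] {h : X → ℝ} (hm : Measurable h) {C : ℝ} (hC : ∀ x, |h x| ≤ C) :
    |∫ x, h x ∂μ - ∫ x, h x ∂ν| ≤ C * tvDist μ ν := by
  have hC0 : 0 ≤ C := by
    obtain ⟨x⟩ := nonempty_of_isProbabilityMeasure μ
    exact (abs_nonneg _).trans (hC x)
  have hint (ρ : Measure X) [IsProbabilityMeasure ρ] : Integrable h ρ :=
    .of_bound hm.aestronglyMeasurable C (Eventually.of_forall hC)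
  have layer (ρ : Measure X) [IsProbabilityMeasure ρ] :
      ∫ x, h x ∂ρ + C = ∫ t in Ioc 0 (2 * C), ρ.real {a | t ≤ h a + C} := by
    rw [← Integrable.integral_eq_integral_Ioc_meas_le (f := fun x => h x + C)
      ((hint ρ).add (integrable_const C))
      (Eventually.of_forall fun x => ?_) (Eventually.of_forall fun x => ?_)]
    · simp [integral_add (hint ρ) (integrable_const C)]
    · have := (abs_le.1 (hC x)).1
      simp only [Pi.zero_apply]; linarith
    · have := (abs_le.1 (hC x)).2
      linarith
  have hmono (ρ : Measure X) [IsProbabilityMeasure ρ] :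
      Antitone fun t : ℝ => ρ.real {a | t ≤ h a + C} := fun s t hst =>
    measureReal_mono fun a (ha : t ≤ h a + C) => hst.trans ha
  have hi (ρ : Measure X) [IsProbabilityMeasure ρ] :
      Integrable (fun t : ℝ => ρ.real {a | t ≤ h a + C}) (volume.restrict (Ioc 0 (2 * C))) :=
    .of_bound (hmono ρ).measurable.aestronglyMeasurable 1 (Eventually.of_forall fun t => by
      simp [abs_of_nonneg, measureReal_le_one])
  have e : ∫ x, h x ∂μ - ∫ x, h x ∂ν = ∫ t in Ioc 0 (2 * C),
      (μ.real {a | t ≤ h a + C} - ν.real {a | t ≤ h a + C}) := by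
    rw [integral_sub (hi μ) (hi ν), ← layer μ, ← layer ν]; ring
  rw [e, ← Real.norm_eq_abs]
  refine (norm_setIntegral_le_of_norm_le_const (C := tvDist μ ν / 2)
    measure_Ioc_lt_top fun t _ =>
    abs_real_sub_real_le_tvDist μ ν
      (measurableSet_le measurable_const (hm.add_const C))).trans_eq ?_
  rw [Real.volume_real_Ioc_of_le (by linarith)]
  ring

/-- Total variation is complete on probability measures. -/
theorem exists_tvDist_le_of_cauchy (m : ℕ → Measure X) [∀ t, IsProbabilityMeasure (m t)]
    {d : ℕ → ℝ} (hd : Tendsto d atTop (𝓝 0)) (h : ∀ s t, s ≤ t → tvDist (m s) (m t) ≤ d s) :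
    ∃ π : Measure X, IsProbabilityMeasure π ∧ ∀ t, tvDist (m t) π ≤ d t := by
  have hsub {A : Set X} (hA : MeasurableSet A) (s t : ℕ) (hst : s ≤ t) :
      |(m s).real A - (m t).real A| ≤ d s / 2 :=
    (abs_real_sub_real_le_tvDist _ _ hA).trans (by linarith [h s t hst])
  have hex (A : Set X) (hA : MeasurableSet A) : ∃ l, Tendsto (fun t => (m t).real A) atTop (𝓝 l) := by
    refine cauchySeq_tendsto_of_complete (cauchySeq_of_le_tendsto_0 d ?_ hd)
    intro s t N hs ht
    have h1 := hsub hA N s hs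
    have h2 := hsub hA N t ht
    rw [Real.dist_eq]
    rw [abs_sub_comm] at h1
    linarith [abs_sub_le ((m s).real A) ((m N).real A) ((m t).real A)]
  set L : Set X → ℝ := fun A => limUnder atTop fun t => (m t).real A with hL
  have hlim (A : Set X) (hA : MeasurableSet A) : Tendsto (fun t => (m t).real A) atTop (𝓝 (L A)) :=
    tendsto_nhds_limUnder (hex A hA)
  have hL0 (A : Set X) (hA : MeasurableSet A) : 0 ≤ L A :=
    ge_of_tendsto' (hlim A hA) fun _ => measureReal_nonneg
  have hclose (A : Set X) (hA : MeasurableSet A) (s : ℕ) : |(m s).real A - L A| ≤ d s / 2 :=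
    le_of_tendsto ((tendsto_const_nhds.sub (hlim A hA)).abs)
      ((eventually_ge_atTop s).mono fun t => hsub hA s t)
  have hsum (f : ℕ → Set X) (hf : ∀ i, MeasurableSet (f i)) (hdis : Pairwise (Function.onFun Disjoint f)) :
      HasSum (fun i => L (f i)) (L (⋃ i, f i)) := by
    rw [hasSum_iff_tendsto_nat_of_nonneg fun i => hL0 _ (hf i)]
    have hU : ∀ n, MeasurableSet (⋃ i ∈ Finset.range n, f i) := fun n =>
      Finset.measurableSet_biUnion _ fun i _ => hf i
    have hadd (ρ : Measure X) [IsProbabilityMeasure ρ] (n : ℕ) :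
        ρ.real (⋃ i ∈ Finset.range n, f i) = ∑ i ∈ Finset.range n, ρ.real (f i) :=
      measureReal_biUnion_finset (fun i _ j _ hij => hdis hij) fun i _ => hf i
    have hfin (n : ℕ) : ∑ i ∈ Finset.range n, L (f i) = L (⋃ i ∈ Finset.range n, f i) := by
      refine tendsto_nhds_unique (tendsto_finsetSum _ fun i _ => hlim _ (hf i)) ?_
      simpa only [hadd] using hlim _ (hU n)
    simp_rw [hfin]
    have hunif : TendstoUniformly (fun t n => (m t).real (⋃ i ∈ Finset.range n, f i))
        (fun n => L (⋃ i ∈ Finset.range n, f i)) atTop := by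
      rw [Metric.tendstoUniformly_iff]
      intro ε hε
      filter_upwards [hd.eventually (gt_mem_nhds hε)] with t ht n
      rw [dist_comm, Real.dist_eq]
      have h1 := hclose _ (hU n) t
      have h2 := abs_nonneg ((m t).real (⋃ i ∈ Finset.range n, f i) - L (⋃ i ∈ Finset.range n, f i))
      linarith
    refine TendstoUniformlyOnFilter.tendsto_of_eventually_tendsto
      (L := fun t => (m t).real (⋃ i, f i))
      (hunif.tendstoUniformlyOnFilter.mono_right le_top) (Eventually.of_forall fun t => ?_)
      (hlim _ (MeasurableSet.iUnion hf))
    simp_rw [hadd]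
    have hfin := measure_iUnion (μ := m t) hdis hf ▸ measure_ne_top (m t) (⋃ i, f i)
    have := ENNReal.hasSum_toReal hfin
    rw [← ENNReal.tsum_toReal_eq (ENNReal.ne_top_of_tsum_ne_top hfin),
      ← measure_iUnion hdis hf] at this
    exact this.tendsto_sum_nat
  let π : Measure X := Measure.ofMeasurable (fun A _ => ENNReal.ofReal (L A))
    (by simp [hL, tendsto_const_nhds.limUnder_eq]) fun f hf hdis => by
      rw [← (hsum f hf hdis).tsum_eq,
        ENNReal.ofReal_tsum_of_nonneg (fun i => hL0 _ (hf i)) (hsum f hf hdis).summable]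
  have hπ (A : Set X) (hA : MeasurableSet A) : π A = ENNReal.ofReal (L A) :=
    Measure.ofMeasurable_apply A hA
  have hπr (A : Set X) (hA : MeasurableSet A) : π.real A = L A := by
    rw [measureReal_def, hπ A hA, ENNReal.toReal_ofReal (hL0 A hA)]
  refine ⟨π, ⟨?_⟩, fun t => ?_⟩
  · rw [hπ _ .univ, ENNReal.ofReal_eq_one]
    exact tendsto_nhds_unique (hlim _ .univ) (by simp)
  · have := tvDist_le_of_forall (μ := m t) (ν := π) (r := d t / 2) fun A hA => by
      rw [hπr A hA]; exact hclose A hA t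
    linarith

end TotalVariation

section Contraction

variable {X : Type*} [MeasurableSpace X]

instance isProbabilityMeasure_iterate_bind (κ : Kernel X X) [IsMarkovKernel κ] (μ : Measure X)
    [IsProbabilityMeasure μ] (t : ℕ) :
    IsProbabilityMeasure ((fun ρ : Measure X => ρ.bind κ)^[t] μ) := by
  induction t with
  | zero => simpa
  | succ t ih => rw [Function.iterate_succ_apply']; infer_instance

/-- The kernel `κ` contracts total variation by the factor `α`. -/
def ContractsTV (κ : Kernel X X) (α : ℝ) : Prop :=
  ∀ π π' : Measure X, IsProbabilityMeasure π → IsProbabilityMeasure π' →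
    tvDist (π.bind κ) (π'.bind κ) ≤ α * tvDist π π'

variable {κ : Kernel X X} [IsMarkovKernel κ] {α : ℝ}

theorem ContractsTV.tvDist_iterate_le (h : ContractsTV κ α) (hα : 0 ≤ α) (μ ν : Measure X)
    [IsProbabilityMeasure μ] [IsProbabilityMeasure ν] (t : ℕ) :
    tvDist ((fun ρ : Measure X => ρ.bind κ)^[t] μ) ((fun ρ : Measure X => ρ.bind κ)^[t] ν)
      ≤ α ^ t * 2 := by
  induction t with
  | zero => simpa using tvDist_le_two μ ν
  | succ t ih =>
    rw [Function.iterate_succ_apply', Function.iterate_succ_apply', pow_succ', mul_assoc]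
    exact (h _ _ inferInstance inferInstance).trans (mul_le_mul_of_nonneg_left ih hα)

theorem ContractsTV.existsUnique_invariant [Nonempty X] (h : ContractsTV κ α) (hα : 0 ≤ α)
    (hα1 : α < 1) : ∃! π : Measure X, IsProbabilityMeasure π ∧ Kernel.Invariant κ π := by
  obtain ⟨x⟩ := ‹Nonempty X›
  have hpow : Tendsto (fun t : ℕ => α ^ t * 2) atTop (𝓝 0) := by
    simpa using (tendsto_pow_atTop_nhds_zero_of_lt_one hα hα1).mul_const 2
  obtain ⟨π, hπ, hconv⟩ := exists_tvDist_le_of_cauchy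
    (fun t => (fun ρ : Measure X => ρ.bind κ)^[t] (Measure.dirac x)) hpow fun s t hst => by
      obtain ⟨k, rfl⟩ := Nat.exists_eq_add_of_le hst
      rw [Function.iterate_add_apply]
      exact h.tvDist_iterate_le hα _ _ s
  have hinv : π.bind κ = π := by
    refine eq_of_tvDist_nonpos (ge_of_tendsto' (f := fun t : ℕ => α * (α ^ t * 2) + α ^ (t + 1) * 2)
      (x := atTop) (by simpa using (hpow.const_mul α).add (hpow.comp (tendsto_add_atTop_nat 1)))
      fun t => ?_)
    have h1 := h π ((fun ρ : Measure X => ρ.bind κ)^[t] (.dirac x)) hπ inferInstance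
    have h2 := hconv (t + 1)
    have h3 := tvDist_triangle (π.bind κ)
      ((fun ρ : Measure X => ρ.bind κ)^[t + 1] (Measure.dirac x)) π
    have h4 := mul_le_mul_of_nonneg_left (hconv t) hα
    rw [tvDist_comm] at h4
    rw [Function.iterate_succ_apply'] at h2 h3
    linarith
  refine ⟨π, ⟨hπ, hinv⟩, fun π' ⟨hπ', hinv'⟩ => eq_of_tvDist_nonpos ?_⟩
  have h1 := h π' π hπ' hπ
  rw [hinv, Kernel.Invariant.def hinv'] at h1
  nlinarith [tvDist_nonneg π' π]

end Contraction

section AverageCost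

variable {X U : Type*} [MeasurableSpace X] [MeasurableSpace U]
  (T : Kernel (X × U) X) (γ : Kernel X U) [IsMarkovKernel γ]

theorem bind_stateKernel (π : Measure X) [SFinite π] :
    π.bind (stateKernel T γ) = (π ⊗ₘ γ).bind T := by
  rw [stateKernel, Measure.compProd_eq_comp_prod, Measure.comp_assoc]

variable [IsMarkovKernel T]

instance isMarkovKernel_stateKernel : IsMarkovKernel (stateKernel T γ) := by
  unfold stateKernel; infer_instance

theorem bind_stateActionKernel (μ : Measure (X × U)) [IsProbabilityMeasure μ] :
    μ.bind (stateActionKernel T γ) = (μ.bind T) ⊗ₘ γ := by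
  ext s hs
  rw [stateActionKernel, Measure.bind_apply hs (Kernel.aemeasurable _),
    Measure.compProd_apply hs, Measure.lintegral_bind (Kernel.aemeasurable _)
      (Kernel.measurable_kernel_prodMk_left hs).aemeasurable]
  refine lintegral_congr fun z => ?_
  rw [Kernel.compProd_apply hs]
  rfl

/-- The state-action pair at time `t` has law `(π Pᵗ) ⊗ γ`. -/
theorem map_eval_pathMeasure (x : X) (t : ℕ) :
    (pathMeasure T γ x).map (fun ω => ω t) =
      (fun ρ : Measure X => ρ.bind (stateKernel T γ))^[t] (Measure.dirac x) ⊗ₘ γ := by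
  induction t with
  | zero =>
    have h0 : (fun ω : ℕ → X × U => ω 0) =
        (MeasurableEquiv.piUnique fun _ : Finset.Iic 0 => X × U) ∘ Preorder.frestrictLe 0 := rfl
    rw [Function.iterate_zero, id, pathMeasure, Kernel.trajMeasure, h0,
      ← Measure.map_map (by fun_prop) (by fun_prop), Measure.map_comp _ _ (by fun_prop),
      Kernel.traj_map_frestrictLe, Kernel.partialTraj_self, Measure.id_comp,
      Measure.map_map (by fun_prop) (by fun_prop), MeasurableEquiv.self_comp_symm, Measure.map_id]
  | succ t ih =>
    rw [Function.iterate_succ_apply', bind_stateKernel, ← bind_stateActionKernel, ← ih]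
    have key := Kernel.map_frestrictLe_trajMeasure_compProd_eq_map_trajMeasure
      (X := fun _ : ℕ => X × U) (μ₀ := Measure.dirac x ⊗ₘ γ)
      (κ := fun t => (stateActionKernel T γ).comap
        (fun h : (i : Finset.Iic t) → X × U => h ⟨t, Finset.mem_Iic.2 le_rfl⟩)
        (measurable_pi_apply _)) (a := t)
    have key2 := congrArg Measure.snd key
    rw [Measure.snd_compProd, Measure.snd_map_prodMk (by fun_prop)] at key2
    refine key2.symm.trans ?_
    unfold pathMeasure
    ext s hs
    rw [Measure.bind_apply hs (Kernel.aemeasurable _), Measure.bind_apply hs (Kernel.aemeasurable _),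
      lintegral_map (Kernel.measurable_coe _ hs) (by fun_prop),
      lintegral_map (Kernel.measurable_coe _ hs) (by fun_prop)]
    rfl

/-- Under a contraction, the average cost from any initial state is the stationary cost. -/
theorem avgCost_eq_integral {α : ℝ} (hα : 0 ≤ α) (hα1 : α < 1) {c : X × U → ℝ} (hc : Measurable c)
    {C : ℝ} (hC : ∀ z, |c z| ≤ C) (h : ContractsTV (stateKernel T γ) α) {π : Measure X}
    [IsProbabilityMeasure π] (hπ : Kernel.Invariant (stateKernel T γ) π) (x : X) :
    avgCost T c γ x = ∫ z, c z ∂(π ⊗ₘ γ) := by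
  have : IsProbabilityMeasure (pathMeasure T γ x) := by unfold pathMeasure; infer_instance
  have hci (μ : Measure (X × U)) [IsProbabilityMeasure μ] : Integrable c μ :=
    .of_bound hc.aestronglyMeasurable C (Eventually.of_forall hC)
  have hmeas : Measurable fun x => ∫ u, c (x, u) ∂(γ x) :=
    (hc.stronglyMeasurable.integral_kernel_prod_right').measurable
  have hbd (x : X) : |∫ u, c (x, u) ∂(γ x)| ≤ C := by
    simpa using norm_integral_le_of_norm_le_const (μ := γ x) (f := fun u => c (x, u))
      (Eventually.of_forall fun u => hC (x, u))
  set m : ℕ → Measure X :=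
    fun t => (fun ρ : Measure X => ρ.bind (stateKernel T γ))^[t] (Measure.dirac x) with hm
  have hterm (t : ℕ) : ∫ ω, c (ω t) ∂(pathMeasure T γ x) = ∫ y, ∫ u, c (y, u) ∂(γ y) ∂(m t) := by
    rw [← integral_map (φ := fun ω : ℕ → X × U => ω t) (measurable_pi_apply t).aemeasurable hc.aestronglyMeasurable,
      map_eval_pathMeasure, Measure.integral_compProd (hci _)]
  have hinvt (t : ℕ) : (fun ρ : Measure X => ρ.bind (stateKernel T γ))^[t] π = π :=
    Function.iterate_fixed (f := fun ρ : Measure X => ρ.bind (stateKernel T γ)) hπ t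
  have hpow : Tendsto (fun t : ℕ => C * (α ^ t * 2)) atTop (𝓝 0) := by
    simpa using ((tendsto_pow_atTop_nhds_zero_of_lt_one hα hα1).mul_const 2).const_mul C
  have hC0 : 0 ≤ C := (abs_nonneg _).trans (hbd x)
  have hlim : Tendsto (fun t => ∫ ω, c (ω t) ∂(pathMeasure T γ x)) atTop
      (𝓝 (∫ z, c z ∂(π ⊗ₘ γ))) := by
    rw [tendsto_iff_dist_tendsto_zero]
    refine squeeze_zero (fun _ => dist_nonneg) (fun t => ?_) hpow
    rw [Real.dist_eq, hterm, Measure.integral_compProd (hci _)]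
    refine (abs_integral_sub_integral_le_tvDist _ _ hmeas hbd).trans ?_
    have := h.tvDist_iterate_le hα (.dirac x) π t
    rw [hinvt] at this
    exact mul_le_mul_of_nonneg_left this hC0
  have hces := hlim.cesaro
  refine Tendsto.limsup_eq (hces.congr fun N => ?_)
  rw [integral_finsetSum _ fun t _ => ?_, one_div]
  exact .of_bound (hc.comp (measurable_pi_apply t)).aestronglyMeasurable C
    (Eventually.of_forall fun ω => hC _)

end AverageCost

section Domination

variable {X : Type*} [TopologicalSpace X] [SecondCountableTopology X] [MeasurableSpace X]
  [OpensMeasurableSpace X]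

/-- A family of measures with continuous densities is dominated by a finite measure. -/
theorem exists_finite_dominating {ι : Type*} {κ : ι → Measure X} [∀ z, IsFiniteMeasure (κ z)]
    {ψ : Measure X} {f : ι → X → ℝ} (hf : ∀ z, Continuous (f z))
    (hκ : ∀ z, κ z = ψ.withDensity fun y => ENNReal.ofReal (f z y)) :
    ∃ l : Measure X, IsFiniteMeasure l ∧ ∀ z, κ z ≪ l := by
  obtain ⟨S, hS, hSU⟩ := TopologicalSpace.isOpen_iUnion_countable (fun z => {y | 0 < f z y})
    fun z => isOpen_lt continuous_const (hf z)
  have := hS.to_subtype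
  refine ⟨(Measure.sum fun z : S => κ z).toFinite, inferInstance, fun z => ?_⟩
  refine Measure.AbsolutelyContinuous.trans ?_ (absolutelyContinuous_toFinite _)
  refine Measure.AbsolutelyContinuous.mk fun A hA h0 => ?_
  rw [Measure.sum_apply _ hA, ENNReal.tsum_eq_zero] at h0
  have hnull (z : ι) : κ z A = 0 ↔ ∀ᵐ y ∂(ψ.restrict A), f z y ≤ 0 := by
    rw [hκ, withDensity_apply _ hA, lintegral_eq_zero_iff (by have := (hf z).measurable; fun_prop)]
    simp [EventuallyEq]
  rw [hnull]
  have hall : ∀ᵐ y ∂(ψ.restrict A), ∀ z' : S, f z' y ≤ 0 :=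
    ae_all_iff.2 fun z' => (hnull z').1 (h0 z')
  filter_upwards [hall] with y hy
  by_contra! hpos
  have : y ∈ ⋃ i ∈ S, {y | 0 < f i y} := hSU ▸ mem_iUnion.2 ⟨z, hpos⟩
  simp only [mem_iUnion] at this
  obtain ⟨i, hi, hyi⟩ := this
  exact absurd (hy ⟨i, hi⟩) (not_le.2 hyi)

end Domination

section Cells

variable {X : Type*} [TopologicalSpace X] [SecondCountableTopology X] [MeasurableSpace X]
  [OpensMeasurableSpace X]

/-- A measure without atoms splits the space into countably many cells of small mass. -/
theorem exists_measurable_cells (π : Measure X) [NullSingletonClass π] [π.OuterRegular] {δ : ENNReal}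
    (hδ : 0 < δ) : ∃ cell : X → ℕ, Measurable cell ∧ ∀ j, π (cell ⁻¹' {j}) ≤ δ := by
  classical
  rcases isEmpty_or_nonempty X with hX | hX
  · exact ⟨fun _ => 0, measurable_const, fun j => by simp [Set.eq_empty_of_isEmpty]⟩
  have hV (x : X) : ∃ V, {x} ⊆ V ∧ IsOpen V ∧ π V < δ :=
    Set.exists_isOpen_lt_of_lt {x} δ (by simpa)
  choose V hxV hVo hVδ using hV
  obtain ⟨S, hS, hSU⟩ := TopologicalSpace.countable_cover_nhds
    fun x => (hVo x).mem_nhds (hxV x rfl)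
  have hSne : S.Nonempty := by
    obtain ⟨x⟩ := hX
    obtain ⟨i, hi, -⟩ := mem_iUnion₂.1 (hSU ▸ mem_univ x)
    exact ⟨i, hi⟩
  obtain ⟨e, rfl⟩ := hS.exists_eq_range hSne
  have hp (x : X) : ∃ N, x ∈ V (e N) := by
    obtain ⟨_, ⟨N, rfl⟩, hx⟩ := mem_iUnion₂.1 (hSU ▸ mem_univ x)
    exact ⟨N, hx⟩
  refine ⟨fun x => Nat.find (hp x), measurable_find hp fun k => (hVo _).measurableSet, fun j => ?_⟩
  refine (measure_mono fun x hx => ?_).trans (hVδ (e j)).le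
  rw [← (mem_singleton_iff.1 hx : Nat.find (hp x) = j)]
  exact Nat.find_spec (hp x)

end Cells

open unitInterval

theorem integrable_of_abs_le {Ω : Type*} [MeasurableSpace Ω] {μ : Measure Ω} [IsFiniteMeasure μ]
    {g : Ω → ℝ} (hg : Measurable g) {K : ℝ} (hK : ∀ a, |g a| ≤ K) : Integrable g μ :=
  .of_bound hg.aestronglyMeasurable K (Eventually.of_forall hK)

theorem abs_integral_le_of_abs_le {Ω : Type*} [MeasurableSpace Ω] {μ : Measure Ω}
    [IsProbabilityMeasure μ] {g : Ω → ℝ} {K : ℝ} (hK : ∀ a, |g a| ≤ K) : |∫ a, g a ∂μ| ≤ K := by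
  simpa using norm_integral_le_of_norm_le_const (μ := μ) (f := g) (Eventually.of_forall hK)

section RandomSelector

variable {X U : Type*} [MeasurableSpace X] [MeasurableSpace U]

/-- A random policy: all states in the same cell use the same sample of an i.i.d. sequence `ω`. -/
def randomSelector (Q : X → I → U) (cell : X → ℕ) (ω : ℕ → I) (x : X) : U := Q x (ω (cell x))

/-- The law of an i.i.d. sequence of uniform variables. -/
noncomputable abbrev uniformSequence : Measure (ℕ → I) := Measure.infinitePi fun _ => volume

variable {Q : X → I → U} {cell : X → ℕ}

theorem measurable_randomSelector (hQ : Measurable (Function.uncurry Q)) (hcell : Measurable cell) :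
    Measurable fun p : (ℕ → I) × X => randomSelector Q cell p.1 p.2 := by
  have hev : Measurable fun p : (ℕ → I) × ℕ => p.1 p.2 :=
    measurable_from_prod_countable_left fun n => measurable_pi_apply n
  exact hQ.comp (measurable_snd.prodMk
    (hev.comp (measurable_fst.prodMk (hcell.comp measurable_snd))))

variable {γ : Kernel X U}

theorem integral_randomSelector_mul (hQ : Measurable (Function.uncurry Q))
    (hγ : ∀ x, (volume : Measure I).map (Q x) = γ x) {φ : X × U → ℝ} (hφ : Measurable φ)
    {x x' : X} (hxx' : cell x ≠ cell x') :
    ∫ ω, φ (x, randomSelector Q cell ω x) * φ (x', randomSelector Q cell ω x') ∂uniformSequence =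
      (∫ u, φ (x, u) ∂(γ x)) * ∫ u, φ (x', u) ∂(γ x') := by
  have hφx (x : X) : Measurable fun u => φ (x, u) := hφ.comp measurable_prodMk_left
  have hQx (x : X) : Measurable (Q x) := hQ.of_uncurry_left
  rw [← hγ x, ← hγ x', integral_map (hQx x).aemeasurable (hφx x).aestronglyMeasurable,
    integral_map (hQx x').aemeasurable (hφx x').aestronglyMeasurable, ← integral_prod_mul,
    ← Measure.infinitePi_map_eval_prod (P := fun _ : ℕ => (volume : Measure I)) hxx',
    integral_map (f := fun s : I × I => φ (x, Q x s.1) * φ (x', Q x' s.2)) (by fun_prop)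
      (Measurable.aestronglyMeasurable
      ((((hφx x).comp (hQx x)).comp measurable_fst).mul
        (((hφx x').comp (hQx x')).comp measurable_snd)))]
  rfl

variable {π : Measure X} [IsProbabilityMeasure π]

theorem integral_sq_randomSelector_le (hQ : Measurable (Function.uncurry Q))
    (hcell : Measurable cell) (hγ : ∀ x, (volume : Measure I).map (Q x) = γ x)
    {δ : ℝ} (hδ : 0 ≤ δ) (hπ : ∀ j, π (cell ⁻¹' {j}) ≤ ENNReal.ofReal δ)
    {φ : X × U → ℝ} (hφ : Measurable φ) {M : ℝ} (hM : ∀ z, |φ z| ≤ M)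
    (h0 : ∀ x, ∫ u, φ (x, u) ∂(γ x) = 0) :
    ∫ ω, (∫ x, φ (x, randomSelector Q cell ω x) ∂π) ^ 2 ∂uniformSequence ≤ M ^ 2 * δ := by
  have hsel := measurable_randomSelector hQ hcell
  have hmeas : Measurable fun p : (ℕ → I) × (X × X) =>
      φ (p.2.1, randomSelector Q cell p.1 p.2.1) * φ (p.2.2, randomSelector Q cell p.1 p.2.2) := by
    have h1 : Measurable fun p : (ℕ → I) × (X × X) => randomSelector Q cell p.1 p.2.1 :=
      hsel.comp (f := fun p : (ℕ → I) × (X × X) => (p.1, p.2.1)) (by fun_prop)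
    have h2 : Measurable fun p : (ℕ → I) × (X × X) => randomSelector Q cell p.1 p.2.2 :=
      hsel.comp (f := fun p : (ℕ → I) × (X × X) => (p.1, p.2.2)) (by fun_prop)
    fun_prop
  have hbd (z z' : X × U) : |φ z * φ z'| ≤ M ^ 2 := by
    rw [abs_mul, sq]
    exact mul_le_mul (hM z) (hM z') (abs_nonneg _) ((abs_nonneg _).trans (hM z))
  have hdiag : MeasurableSet {p : X × X | cell p.1 = cell p.2} :=
    measurableSet_eq_fun (hcell.comp measurable_fst) (hcell.comp measurable_snd)
  have hmass : (π.prod π).real {p : X × X | cell p.1 = cell p.2} ≤ δ := by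
    refine ENNReal.toReal_le_of_le_ofReal hδ ?_
    rw [Measure.prod_apply hdiag]
    calc ∫⁻ x, π (Prod.mk x ⁻¹' {p : X × X | cell p.1 = cell p.2}) ∂π
        ≤ ∫⁻ _, ENNReal.ofReal δ ∂π := lintegral_mono fun x => by
          refine (measure_mono fun y hy => ?_).trans (hπ (cell x))
          exact (mem_preimage.1 hy : cell x = cell y).symm
      _ = ENNReal.ofReal δ := by simp
  calc ∫ ω, (∫ x, φ (x, randomSelector Q cell ω x) ∂π) ^ 2 ∂uniformSequence
      = ∫ ω, ∫ p : X × X, φ (p.1, randomSelector Q cell ω p.1) *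
          φ (p.2, randomSelector Q cell ω p.2) ∂(π.prod π) ∂uniformSequence := by
        refine integral_congr_ae (Eventually.of_forall fun ω => ?_)
        simp only [sq]
        rw [← integral_prod_mul]
    _ = ∫ p : X × X, ∫ ω, φ (p.1, randomSelector Q cell ω p.1) *
          φ (p.2, randomSelector Q cell ω p.2) ∂uniformSequence ∂(π.prod π) :=
        integral_integral_swap (.of_bound hmeas.aestronglyMeasurable (M ^ 2)
          (Eventually.of_forall fun _ => hbd _ _))
    _ ≤ ∫ p : X × X, {p : X × X | cell p.1 = cell p.2}.indicator (fun _ => M ^ 2) p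
          ∂(π.prod π) := by
        have hb (p : X × X) := abs_integral_le_of_abs_le (μ := uniformSequence) fun ω =>
          hbd (p.1, randomSelector Q cell ω p.1) (p.2, randomSelector Q cell ω p.2)
        refine integral_mono (integrable_of_abs_le
          ((hmeas.stronglyMeasurable.integral_prod_left' (μ := uniformSequence)).measurable) hb)
          ((integrable_const _).indicator hdiag) fun p => ?_
        by_cases hp : p ∈ {p : X × X | cell p.1 = cell p.2}
        · rw [indicator_of_mem hp]
          exact (le_abs_self _).trans (hb p)
        · rw [indicator_of_notMem hp]
          exact (integral_randomSelector_mul hQ hγ hφ hp).trans_le (by simp [h0])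
    _ ≤ M ^ 2 * δ := by
        rw [integral_indicator_const _ hdiag, smul_eq_mul, mul_comm]
        exact mul_le_mul_of_nonneg_left hmass (sq_nonneg M)

/-- The deviation of a random policy from the randomized policy it samples. -/
noncomputable def selectorDeviation (π : Measure X) (γ : Kernel X U) (Q : X → I → U) (cell : X → ℕ)
    (φ : X × U → ℝ) (ω : ℕ → I) : ℝ :=
  |∫ x, φ (x, randomSelector Q cell ω x) ∂π - ∫ z, φ z ∂(π ⊗ₘ γ)|

theorem measurable_selectorDeviation {Y : Type*} [MeasurableSpace Y]
    (hQ : Measurable (Function.uncurry Q)) (hcell : Measurable cell) {φ : Y → X × U → ℝ}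
    (hφ : Measurable (Function.uncurry φ)) :
    Measurable fun p : (ℕ → I) × Y => selectorDeviation π γ Q cell (φ p.2) p.1 := by
  have hsel := measurable_randomSelector hQ hcell
  have h1 : Measurable fun p : ((ℕ → I) × Y) × X => randomSelector Q cell p.1.1 p.2 :=
    hsel.comp (f := fun p : ((ℕ → I) × Y) × X => (p.1.1, p.2)) (by fun_prop)
  have h2 : Measurable fun p : ((ℕ → I) × Y) × X =>
      φ p.1.2 (p.2, randomSelector Q cell p.1.1 p.2) :=
    hφ.comp (f := fun p : ((ℕ → I) × Y) × X => (p.1.2, (p.2, randomSelector Q cell p.1.1 p.2)))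
      (by fun_prop)
  have h3 : Measurable fun p : ((ℕ → I) × Y) × (X × U) => φ p.1.2 p.2 :=
    hφ.comp (f := fun p : ((ℕ → I) × Y) × (X × U) => (p.1.2, p.2)) (by fun_prop)
  have h4 := (h2.stronglyMeasurable.integral_prod_right' (ν := π)).measurable
  have h5 := (h3.stronglyMeasurable.integral_prod_right' (ν := π ⊗ₘ γ)).measurable
  exact continuous_abs.measurable.comp (h4.sub h5)

variable [IsMarkovKernel γ]

theorem selectorDeviation_le {φ : X × U → ℝ} {M : ℝ} (hM : ∀ z, |φ z| ≤ M) (ω : ℕ → I) :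
    selectorDeviation π γ Q cell φ ω ≤ 2 * M := by
  have h1 : |∫ x, φ (x, randomSelector Q cell ω x) ∂π| ≤ M := abs_integral_le_of_abs_le fun _ => hM _
  have h2 : |∫ z, φ z ∂(π ⊗ₘ γ)| ≤ M := abs_integral_le_of_abs_le hM
  exact (abs_sub _ _).trans (by linarith)

theorem integral_selectorDeviation_le (hQ : Measurable (Function.uncurry Q))
    (hcell : Measurable cell) (hγ : ∀ x, (volume : Measure I).map (Q x) = γ x)
    {η : ℝ} (hη : 0 < η) (hπ : ∀ j, π (cell ⁻¹' {j}) ≤ ENNReal.ofReal (η ^ 2))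
    {φ : X × U → ℝ} (hφ : Measurable φ) {M : ℝ} (hM0 : 0 < M) (hM : ∀ z, |φ z| ≤ M) :
    ∫ ω, selectorDeviation π γ Q cell φ ω ∂uniformSequence ≤ 2 * M * η := by
  have hsel := measurable_randomSelector hQ hcell
  have hmean : Measurable fun x => ∫ u, φ (x, u) ∂(γ x) :=
    (hφ.stronglyMeasurable.integral_kernel_prod_right').measurable
  have hmeanb (x : X) : |∫ u, φ (x, u) ∂(γ x)| ≤ M := abs_integral_le_of_abs_le fun _ => hM _
  set φ₀ : X × U → ℝ := fun z => φ z - ∫ u, φ (z.1, u) ∂(γ z.1) with hφ₀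
  have hφ₀m : Measurable φ₀ := hφ.sub (hmean.comp measurable_fst)
  have hφ₀b (z : X × U) : |φ₀ z| ≤ 2 * M :=
    (abs_sub _ _).trans (by linarith [hM z, hmeanb z.1])
  have h0 (x : X) : ∫ u, φ₀ (x, u) ∂(γ x) = 0 := by
    have : Integrable (fun u => φ (x, u)) (γ x) :=
      integrable_of_abs_le (hφ.comp measurable_prodMk_left) fun _ => hM _
    simp only [hφ₀]
    rw [integral_sub this (integrable_const _)]
    simp
  have hdev (ω : ℕ → I) : selectorDeviation π γ Q cell φ ω =
      |∫ x, φ₀ (x, randomSelector Q cell ω x) ∂π| := by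
    have hs : Measurable (randomSelector Q cell ω) := hsel.comp measurable_prodMk_left
    have h1 : Integrable (fun x => φ (x, randomSelector Q cell ω x)) π :=
      integrable_of_abs_le (by fun_prop) fun _ => hM _
    have h2 : Integrable (fun x => ∫ u, φ (x, u) ∂(γ x)) π := integrable_of_abs_le hmean hmeanb
    simp only [hφ₀]
    rw [integral_sub h1 h2, selectorDeviation,
      Measure.integral_compProd (integrable_of_abs_le hφ hM)]
  have hZ : Measurable fun ω => ∫ x, φ₀ (x, randomSelector Q cell ω x) ∂π := by
    have : Measurable fun p : (ℕ → I) × X => φ₀ (p.2, randomSelector Q cell p.1 p.2) := by fun_prop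
    exact (this.stronglyMeasurable.integral_prod_right' (ν := π)).measurable
  have hZb (ω : ℕ → I) : |∫ x, φ₀ (x, randomSelector Q cell ω x) ∂π| ≤ 2 * M :=
    abs_integral_le_of_abs_le fun _ => hφ₀b _
  have hsq := integral_sq_randomSelector_le hQ hcell hγ (sq_nonneg η) hπ hφ₀m hφ₀b h0
  simp_rw [hdev]
  have hintsq : Integrable (fun ω => (∫ x, φ₀ (x, randomSelector Q cell ω x) ∂π) ^ 2)
      uniformSequence :=
    integrable_of_abs_le (hZ.pow_const 2) (K := (2 * M) ^ 2) fun ω => by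
      rw [abs_pow]; exact pow_le_pow_left₀ (abs_nonneg _) (hZb ω) 2
  have hpos : 0 < 2 * M * η := by positivity
  calc ∫ ω, |∫ x, φ₀ (x, randomSelector Q cell ω x) ∂π| ∂uniformSequence
      ≤ ∫ ω, ((∫ x, φ₀ (x, randomSelector Q cell ω x) ∂π) ^ 2 / (2 * (2 * M * η)) +
          2 * M * η / 2) ∂uniformSequence := by
        refine integral_mono (integrable_of_abs_le hZ hZb).abs
          ((hintsq.div_const _).add (integrable_const _)) fun ω => ?_
        simp only
        rw [← sq_abs, div_add_div _ _ (by positivity) two_ne_zero, le_div_iff₀ (by positivity)]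
        nlinarith [sq_nonneg (|∫ x, φ₀ (x, randomSelector Q cell ω x) ∂π| - 2 * M * η)]
    _ = (∫ ω, (∫ x, φ₀ (x, randomSelector Q cell ω x) ∂π) ^ 2 ∂uniformSequence) /
          (2 * (2 * M * η)) + 2 * M * η / 2 := by
        rw [integral_add (hintsq.div_const _) (integrable_const _), integral_div]
        simp
    _ ≤ 2 * M * η := by
        rw [← le_sub_iff_add_le, div_le_iff₀ (by positivity)]
        linarith

end RandomSelector

section Truncation

variable {X Z : Type*} [MeasurableSpace X] [MeasurableSpace Z] {T : Kernel Z X} [IsMarkovKernel T]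

theorem real_bind_eq_integral (μ : Measure Z) [IsProbabilityMeasure μ] {A : Set X}
    (hA : MeasurableSet A) : (μ.bind T).real A = ∫ z, (T z).real A ∂μ := by
  rw [measureReal_def, Measure.bind_apply hA (Kernel.aemeasurable _)]
  exact (integral_toReal (Kernel.measurable_coe T hA).aemeasurable
    (Eventually.of_forall fun z => measure_lt_top _ _)).symm

/-- A dominated kernel is approximated from below by kernels with bounded densities. -/
theorem exists_bounded_density [MeasurableSpace.CountableOrCountablyGenerated Z X]
    {l : Measure X} [IsFiniteMeasure l] (hT : ∀ z, T z ≪ l) (μ : Measure Z)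
    [IsProbabilityMeasure μ] {ε : ℝ} (hε : 0 < ε) :
    ∃ (M : ℝ) (q : X → Z → ℝ) (ρ : Z → ℝ), 0 < M ∧ Measurable (Function.uncurry q) ∧
      (∀ y z, |q y z| ≤ M) ∧ Measurable ρ ∧ (∀ z, |ρ z| ≤ 1) ∧ ∫ z, ρ z ∂μ < ε ∧
      ∀ z A, MeasurableSet A → |(T z).real A - ∫ y in A, q y z ∂l| ≤ ρ z := by
  set p : Z → X → ℝ := fun z y => (Kernel.rnDeriv T (Kernel.const Z l) z y).toReal with hp
  have hpm : Measurable fun s : Z × X => p s.1 s.2 :=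
    (Kernel.measurable_rnDeriv T (Kernel.const Z l)).ennreal_toReal
  have hp0 (z : Z) (y : X) : 0 ≤ p z y := ENNReal.toReal_nonneg
  have hTz (z : Z) : T z = l.withDensity (Kernel.rnDeriv T (Kernel.const Z l) z) := by
    have := Kernel.withDensity_rnDeriv_eq (κ := T) (η := Kernel.const Z l) (a := z)
      (by simpa using hT z)
    rw [Kernel.withDensity_apply _ (Kernel.measurable_rnDeriv _ _), Kernel.const_apply] at this
    exact this.symm
  have hlint (z : Z) (A : Set X) (hA : MeasurableSet A) :
      ∫⁻ y in A, Kernel.rnDeriv T (Kernel.const Z l) z y ∂l = T z A := by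
    conv_rhs => rw [hTz z, withDensity_apply _ hA]
  have hpint (z : Z) : Integrable (p z) l :=
    integrable_toReal_of_lintegral_ne_top (Kernel.measurable_rnDeriv_right _ _ _).aemeasurable
      (by rw [← setLIntegral_univ, hlint z _ .univ]; exact measure_ne_top _ _)
  have hpA (z : Z) (A : Set X) (hA : MeasurableSet A) : (T z).real A = ∫ y in A, p z y ∂l := by
    rw [measureReal_def, ← hlint z A hA]
    refine (integral_toReal (Kernel.measurable_rnDeriv_right _ _ _).aemeasurable ?_).symm
    refine ae_lt_top (Kernel.measurable_rnDeriv_right _ _ _) ?_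
    rw [hlint z A hA]; exact measure_ne_top _ _
  have hp1 (z : Z) : ∫ y, p z y ∂l = 1 := by
    rw [← setIntegral_univ, ← hpA z _ .univ]; simp
  set q : ℕ → X → Z → ℝ := fun M y z => min (p z y) M with hq
  have hqm (M : ℕ) : Measurable (Function.uncurry (q M)) :=
    (hpm.comp measurable_swap).min measurable_const
  have hq0 (M : ℕ) (y : X) (z : Z) : 0 ≤ q M y z := le_min (hp0 z y) M.cast_nonneg
  have hqp (M : ℕ) (y : X) (z : Z) : q M y z ≤ p z y := min_le_left _ _
  have hqint (M : ℕ) (z : Z) : Integrable (fun y => q M y z) l :=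
    (hpint z).mono' ((hqm M).comp measurable_prodMk_right).aestronglyMeasurable
      (Eventually.of_forall fun y => by
        rw [Real.norm_of_nonneg (hq0 M y z)]; exact hqp M y z)
  set ρ : ℕ → Z → ℝ := fun M z => ∫ y, (p z y - q M y z) ∂l with hρ
  have hρ0 (M : ℕ) (z : Z) : 0 ≤ ρ M z := integral_nonneg fun y => sub_nonneg.2 (hqp M y z)
  have hρ1 (M : ℕ) (z : Z) : ρ M z ≤ 1 := by
    rw [← hp1 z]
    exact integral_mono ((hpint z).sub (hqint M z)) (hpint z) fun y => sub_le_self _ (hq0 M y z)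
  have hρb (M : ℕ) (z : Z) : |ρ M z| ≤ 1 := by rw [abs_of_nonneg (hρ0 M z)]; exact hρ1 M z
  have hρm (M : ℕ) : Measurable (ρ M) :=
    ((hpm.sub ((hqm M).comp measurable_swap)).stronglyMeasurable.integral_prod_right'
      (ν := l)).measurable
  have hρlim (z : Z) : Tendsto (fun M => ρ M z) atTop (𝓝 0) := by
    have : Tendsto (fun M : ℕ => ∫ y, (p z y - q M y z) ∂l) atTop (𝓝 (∫ _, (0 : ℝ) ∂l)) := by
      refine tendsto_integral_of_dominated_convergence (p z)
        (fun M => ((hpint z).sub (hqint M z)).aestronglyMeasurable) (hpint z)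
        (fun M => Eventually.of_forall fun y => ?_) (Eventually.of_forall fun y => ?_)
      · rw [Real.norm_of_nonneg (sub_nonneg.2 (hqp M y z))]
        exact sub_le_self _ (hq0 M y z)
      · refine tendsto_const_nhds.congr' ?_
        filter_upwards [eventually_ge_atTop ⌈p z y⌉₊] with M hM
        simp [hq, min_eq_left (Nat.ceil_le.1 hM)]
    simpa using this
  have hlim : Tendsto (fun M => ∫ z, ρ M z ∂μ) atTop (𝓝 0) := by
    simpa using tendsto_integral_of_dominated_convergence (μ := μ) (fun _ => (1 : ℝ))
      (fun M => (hρm M).aestronglyMeasurable) (integrable_const _)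
      (fun M => Eventually.of_forall (hρb M)) (Eventually.of_forall hρlim)
  obtain ⟨M, hM, hM0⟩ := ((hlim.eventually (gt_mem_nhds hε)).and (eventually_gt_atTop 0)).exists
  refine ⟨M, q M, ρ M, by exact_mod_cast hM0, hqm M, fun y z => ?_, hρm M, hρb M, hM,
    fun z A hA => ?_⟩
  · rw [abs_of_nonneg (hq0 M y z)]; exact min_le_right _ _
  · rw [hpA z A hA, ← integral_sub (hpint z).integrableOn (hqint M z).integrableOn,
      abs_of_nonneg (integral_nonneg fun y => sub_nonneg.2 (hqp M y z))]
    exact setIntegral_le_integral ((hpint z).sub (hqint M z))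
      (Eventually.of_forall fun y => sub_nonneg.2 (hqp M y z))

theorem tvDist_bind_le {l : Measure X} [IsFiniteMeasure l] {q : X → Z → ℝ} {ρ : Z → ℝ} {M K : ℝ}
    (hq : Measurable (Function.uncurry q)) (hqM : ∀ y z, |q y z| ≤ M) (hρ : Measurable ρ)
    (hρK : ∀ z, |ρ z| ≤ K)
    (hT : ∀ z A, MeasurableSet A → |(T z).real A - ∫ y in A, q y z ∂l| ≤ ρ z)
    (μ ν : Measure Z) [IsProbabilityMeasure μ] [IsProbabilityMeasure ν] :
    tvDist (μ.bind T) (ν.bind T) ≤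
      2 * (∫ y, |∫ z, q y z ∂μ - ∫ z, q y z ∂ν| ∂l + (∫ z, ρ z ∂μ + ∫ z, ρ z ∂ν)) := by
  have hqμ (m : Measure Z) [IsProbabilityMeasure m] : Measurable fun y => ∫ z, q y z ∂m :=
    (hq.stronglyMeasurable.integral_prod_right' (ν := m)).measurable
  have hqi (m : Measure Z) [IsProbabilityMeasure m] : Integrable (fun y => ∫ z, q y z ∂m) l :=
    integrable_of_abs_le (hqμ m) fun y => abs_integral_le_of_abs_le (hqM y)
  refine tvDist_le_of_forall fun A hA => ?_
  have hqA : Measurable fun z => ∫ y in A, q y z ∂l :=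
    ((hq.comp measurable_swap).stronglyMeasurable.integral_prod_right'
      (ν := l.restrict A)).measurable
  have happrox (m : Measure Z) [IsProbabilityMeasure m] :
      |(m.bind T).real A - ∫ y in A, ∫ z, q y z ∂m ∂l| ≤ ∫ z, ρ z ∂m := by
    have hTA : Integrable (fun z => (T z).real A) m :=
      integrable_of_abs_le (Kernel.measurable_coe T hA).ennreal_toReal (K := 1) fun z => by
        rw [abs_of_nonneg measureReal_nonneg]; exact measureReal_le_one
    have hqAi : Integrable (fun z => ∫ y in A, q y z ∂l) m :=
      integrable_of_abs_le hqA (K := M * l.real A) fun z => by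
        rw [← Real.norm_eq_abs]
        exact norm_setIntegral_le_of_norm_le_const (measure_lt_top _ _) fun y _ => hqM y z
    rw [real_bind_eq_integral m hA, integral_integral_swap (μ := l.restrict A) (f := q)
      (integrable_of_abs_le hq fun s => hqM s.1 s.2), ← integral_sub hTA hqAi]
    exact abs_integral_le_integral_abs.trans
      (integral_mono (hTA.sub hqAi).abs (integrable_of_abs_le hρ hρK) fun z => hT z A hA)
  have hmid : |∫ y in A, ∫ z, q y z ∂μ ∂l - ∫ y in A, ∫ z, q y z ∂ν ∂l| ≤
      ∫ y, |∫ z, q y z ∂μ - ∫ z, q y z ∂ν| ∂l := by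
    rw [← integral_sub (hqi μ).integrableOn (hqi ν).integrableOn]
    exact abs_integral_le_integral_abs.trans (setIntegral_le_integral ((hqi μ).sub (hqi ν)).abs
      (Eventually.of_forall fun y => abs_nonneg _))
  have h1 := abs_le.1 (happrox μ)
  have h2 := abs_le.1 (happrox ν)
  have h3 := abs_le.1 hmid
  exact abs_le.2 ⟨by linarith [h1.1, h2.2, h3.1], by linarith [h1.2, h2.1, h3.2]⟩

end Truncation

section DeterministicApproximation

variable {X U : Type*} [TopologicalSpace X] [SecondCountableTopology X] [MeasurableSpace X]
  [OpensMeasurableSpace X] [MeasurableSpace.CountablyGenerated X] [MeasurableSpace U]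
  [StandardBorelSpace U]

/-- For a dominated transition kernel and an initial law without atoms, some deterministic policy has
almost the same one-stage cost and almost the same next-state law as a given randomized policy. -/
theorem exists_deterministic_approximation {T : Kernel (X × U) X} [IsMarkovKernel T]
    {l : Measure X} [IsFiniteMeasure l] (hT : ∀ z, T z ≪ l) (γ : Kernel X U) [IsMarkovKernel γ]
    (π : Measure X) [IsProbabilityMeasure π] [NullSingletonClass π] [π.OuterRegular]
    {c : X × U → ℝ} (hc : Measurable c) {C : ℝ} (hC : ∀ z, |c z| ≤ C) {ε : ℝ} (hε : 0 < ε) :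
    ∃ (f : X → U) (hf : Measurable f),
      |∫ z, c z ∂(π ⊗ₘ Kernel.deterministic f hf) - ∫ z, c z ∂(π ⊗ₘ γ)| < ε ∧
      tvDist (π.bind (stateKernel T (Kernel.deterministic f hf))) (π.bind (stateKernel T γ)) < ε := by
  have : Nonempty U := by
    obtain ⟨x⟩ := nonempty_of_isProbabilityMeasure π
    exact nonempty_of_isProbabilityMeasure (γ x)
  obtain ⟨M, q, ρ, hM0, hq, hqM, hρ, hρ1, hρε, hTq⟩ :=
    exists_bounded_density hT (π ⊗ₘ γ) (ε := ε / 8) (by positivity)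
  obtain ⟨Q, hQ, hγ⟩ := γ.exists_measurable_map_eq_unitInterval
  set K : ℝ := 2 * (|C| + 1) + (l.real univ * (2 * M) + 2 * 1) with hK
  have hKpos : 0 < K := by positivity
  set η : ℝ := ε / (8 * K) with hη
  have hηpos : 0 < η := by positivity
  obtain ⟨cell, hcell, hmass⟩ :=
    exists_measurable_cells π (δ := ENNReal.ofReal (η ^ 2)) (by simpa using by positivity)
  have hC' (z : X × U) : |c z| ≤ |C| + 1 := (hC z).trans (by linarith [le_abs_self C])
  have hdevm {φ : X × U → ℝ} (hφ : Measurable φ) : Measurable (selectorDeviation π γ Q cell φ) :=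
    (measurable_selectorDeviation (Y := Unit) (φ := fun _ => φ) hQ hcell
      (hφ.comp measurable_snd)).comp (measurable_id.prodMk (measurable_const (a := ())))
  have hdev0 (φ : X × U → ℝ) (ω : ℕ → I) : 0 ≤ selectorDeviation π γ Q cell φ ω := abs_nonneg _
  have hdevb {φ : X × U → ℝ} {B : ℝ} (hB : ∀ z, |φ z| ≤ B) (ω : ℕ → I) :
      |selectorDeviation π γ Q cell φ ω| ≤ 2 * B := by
    rw [abs_of_nonneg (hdev0 φ ω)]; exact selectorDeviation_le hB ω
  have hqdevm := measurable_selectorDeviation (π := π) (γ := γ) hQ hcell hq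
  have hqdevi : Integrable (fun p : (ℕ → I) × X => selectorDeviation π γ Q cell (q p.2) p.1)
      (uniformSequence.prod l) :=
    integrable_of_abs_le hqdevm fun p => hdevb (hqM p.2) p.1
  have hic : Integrable (selectorDeviation π γ Q cell c) uniformSequence :=
    integrable_of_abs_le (hdevm hc) (hdevb hC')
  have hiρ : Integrable (selectorDeviation π γ Q cell ρ) uniformSequence :=
    integrable_of_abs_le (hdevm hρ) (hdevb hρ1)
  have hiq : Integrable (fun ω => ∫ y, selectorDeviation π γ Q cell (q y) ω ∂l) uniformSequence :=
    hqdevi.integral_prod_left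
  obtain ⟨ω, hω⟩ := exists_le_integral (hic.add (hiq.add hiρ))
  have hint : ∫ ω, (selectorDeviation π γ Q cell c + ((fun ω => ∫ y, selectorDeviation π γ Q cell
      (q y) ω ∂l) + selectorDeviation π γ Q cell ρ)) ω ∂uniformSequence ≤ K * η := by
    rw [integral_add' hic (hiq.add hiρ), integral_add' hiq hiρ, integral_integral_swap hqdevi]
    have h1 := integral_selectorDeviation_le hQ hcell hγ hηpos hmass hc (by positivity) hC'
    have h2 := integral_selectorDeviation_le hQ hcell hγ hηpos hmass hρ one_pos hρ1
    have h3 : ∫ y, ∫ ω, selectorDeviation π γ Q cell (q y) ω ∂uniformSequence ∂l ≤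
        ∫ _, 2 * M * η ∂l :=
      integral_mono hqdevi.integral_prod_right (integrable_const _) fun y =>
        integral_selectorDeviation_le hQ hcell hγ hηpos hmass (hq.comp measurable_prodMk_left)
          hM0 (hqM y)
    rw [integral_const, smul_eq_mul] at h3
    rw [hK]
    linarith
  have hKη : K * η = ε / 8 := by rw [hη]; field_simp
  have hsum := hω.trans hint
  simp only [Pi.add_apply] at hsum
  have hqω : 0 ≤ ∫ y, selectorDeviation π γ Q cell (q y) ω ∂l := integral_nonneg fun y => hdev0 _ _
  have hf : Measurable (randomSelector Q cell ω) :=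
    (measurable_randomSelector hQ hcell).comp measurable_prodMk_left
  have hmap {φ : X × U → ℝ} (hφ : Measurable φ) :
      ∫ z, φ z ∂(π ⊗ₘ Kernel.deterministic _ hf) = ∫ x, φ (x, randomSelector Q cell ω x) ∂π := by
    rw [Measure.compProd_deterministic, integral_map (by fun_prop) hφ.aestronglyMeasurable]
  have hdev {φ : X × U → ℝ} (hφ : Measurable φ) :
      |∫ z, φ z ∂(π ⊗ₘ Kernel.deterministic _ hf) - ∫ z, φ z ∂(π ⊗ₘ γ)| =
        selectorDeviation π γ Q cell φ ω := by
    rw [hmap hφ, selectorDeviation]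
  refine ⟨randomSelector Q cell ω, hf, ?_, ?_⟩
  · rw [hdev hc]
    linarith [hdev0 ρ ω]
  · rw [bind_stateKernel, bind_stateKernel]
    refine (tvDist_bind_le hq hqM hρ hρ1 hTq _ _).trans_lt ?_
    have h1 := (abs_le.1 (hdev hρ).le).2
    simp_rw [fun y => hdev (φ := q y) (hq.comp measurable_prodMk_left)]
    linarith [hdev0 c ω]

end DeterministicApproximation

section Main

variable {X U : Type*} [MeasurableSpace X] [MeasurableSpace U] {T : Kernel (X × U) X}

theorem TVContraction.contractsTV {α : ℝ} (h : TVContraction T α) (γ : Kernel X U)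
    [IsMarkovKernel γ] : ContractsTV (stateKernel T γ) α :=
  h γ inferInstance

/-- A law which is almost invariant for a contraction is close to the invariant law. -/
theorem ContractsTV.tvDist_invariant_le {κ : Kernel X X} [IsMarkovKernel κ] {α : ℝ}
    (h : ContractsTV κ α) (hα1 : α < 1) {π ρ : Measure X} [IsProbabilityMeasure π]
    [IsProbabilityMeasure ρ] (hρ : Kernel.Invariant κ ρ) :
    tvDist ρ π ≤ tvDist (π.bind κ) π / (1 - α) := by
  have h1 := h ρ π inferInstance inferInstance
  rw [hρ.def] at h1
  rw [le_div_iff₀ (by linarith)]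
  linarith [tvDist_triangle ρ (π.bind κ) π]

theorem abs_integral_compProd_sub_le_tvDist (γ : Kernel X U) [IsMarkovKernel γ] (μ ν : Measure X)
    [IsProbabilityMeasure μ] [IsProbabilityMeasure ν] {c : X × U → ℝ} (hc : Measurable c) {C : ℝ}
    (hC : ∀ z, |c z| ≤ C) :
    |∫ z, c z ∂(μ ⊗ₘ γ) - ∫ z, c z ∂(ν ⊗ₘ γ)| ≤ C * tvDist μ ν := by
  rw [Measure.integral_compProd (integrable_of_abs_le hc hC),
    Measure.integral_compProd (integrable_of_abs_le hc hC)]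
  exact abs_integral_sub_integral_le_tvDist μ ν
    (hc.stronglyMeasurable.integral_kernel_prod_right').measurable
    fun x => abs_integral_le_of_abs_le fun u => hC (x, u)

theorem nullSingletonClass_of_invariant [MeasurableSingletonClass X]
    (hT : ∀ z y, T z {y} = 0) {γ : Kernel X U} [IsMarkovKernel γ] {π : Measure X} [SFinite π]
    (hπ : Kernel.Invariant (stateKernel T γ) π) : NullSingletonClass π := by
  refine ⟨fun y => ?_⟩
  rw [← hπ.def, bind_stateKernel, Measure.bind_apply (measurableSet_singleton y)
    (Kernel.aemeasurable _)]
  simp [hT]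

end Main

end ControlledChain

open ControlledChain in
theorem theorem4p2 (n : ℕ) {U : Type*} [TopologicalSpace U] [PolishSpace U] [CompactSpace U]
    [MeasurableSpace U] [BorelSpace U]
    (T : Kernel (EuclideanSpace ℝ (Fin n) × U) (EuclideanSpace ℝ (Fin n))) [IsMarkovKernel T]
    (c : EuclideanSpace ℝ (Fin n) × U → ℝ) (hc : Measurable c) (hcb : ∃ C, ∀ z, |c z| ≤ C)
    (hG : IsCompact (invariantOccupation T))
    (α : ℝ) (hα0 : 0 ≤ α) (hα1 : α < 1) (hTV : TVContraction T α)
    (ψ : Measure (EuclideanSpace ℝ (Fin n))) (hψ : ∀ y, ψ {y} = 0)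
    (hdens : HasEquicontinuousDensities T ψ)
    (hcont : (WeaklyContinuous T ∧ Continuous c) ∨
      (StronglyContinuousInAction T ∧ ∀ x, Continuous fun u => c (x, u))) :
    (∀ γ : Kernel (EuclideanSpace ℝ (Fin n)) U, IsMarkovKernel γ →
      ∃! π : Measure (EuclideanSpace ℝ (Fin n)),
        IsProbabilityMeasure π ∧ Kernel.Invariant (stateKernel T γ) π) ∧
    ∀ (γ : Kernel (EuclideanSpace ℝ (Fin n)) U) [IsMarkovKernel γ] (ε : ℝ), 0 < ε →
      ∃ (f : EuclideanSpace ℝ (Fin n) → U) (hf : Measurable f),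
        ∀ x, |avgCost T c (Kernel.deterministic f hf) x - avgCost T c γ x| < ε := by
  have hinv (γ : Kernel (EuclideanSpace ℝ (Fin n)) U) [IsMarkovKernel γ] :=
    (hTV.contractsTV γ).existsUnique_invariant hα0 hα1
  refine ⟨fun γ _ => hinv γ, fun γ _ ε hε => ?_⟩
  obtain ⟨C, hC⟩ := hcb
  obtain ⟨d, -, hd, -, hde⟩ := hdens
  obtain ⟨l, _, hl⟩ := exists_finite_dominating (fun z => hde.continuous z) hd
  obtain ⟨π, ⟨_, hπ⟩, -⟩ := hinv γ
  have hTy (z : EuclideanSpace ℝ (Fin n) × U) (y : EuclideanSpace ℝ (Fin n)) : T z {y} = 0 := by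
    rw [hd z]
    exact withDensity_absolutelyContinuous ψ _ (hψ y)
  have := nullSingletonClass_of_invariant hTy hπ
  have hα : 0 < 1 - α := by linarith
  set K : ℝ := 1 + |C| / (1 - α) with hK
  have hKpos : 0 < K := by positivity
  obtain ⟨f, hf, hcost, hTVf⟩ :=
    exists_deterministic_approximation hl γ π hc hC (ε := ε / K) (by positivity)
  refine ⟨f, hf, fun x => ?_⟩
  obtain ⟨ρ, ⟨_, hρ⟩, -⟩ := hinv (Kernel.deterministic f hf)
  rw [avgCost_eq_integral T _ hα0 hα1 hc hC (hTV.contractsTV _) hρ,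
    avgCost_eq_integral T _ hα0 hα1 hc hC (hTV.contractsTV _) hπ]
  have h1 := (hTV.contractsTV (Kernel.deterministic f hf)).tvDist_invariant_le hα1 (π := π) hρ
  rw [hπ.def] at hTVf
  have h2 := abs_integral_compProd_sub_le_tvDist (Kernel.deterministic f hf) ρ π hc
    (fun z => (hC z).trans (le_abs_self C))
  have h3 : |C| * tvDist ρ π ≤ |C| / (1 - α) * (ε / K) := by
    rw [div_mul_eq_mul_div, mul_div_assoc]
    exact mul_le_mul_of_nonneg_left (h1.trans (by gcongr)) (abs_nonneg C)
  have h4 : ε / K + |C| / (1 - α) * (ε / K) = ε := by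
    rw [← one_add_mul, ← hK]; field_simp
  have h5 := abs_sub_le (∫ z, c z ∂(ρ ⊗ₘ Kernel.deterministic f hf))
    (∫ z, c z ∂(π ⊗ₘ Kernel.deterministic f hf)) (∫ z, c z ∂(π ⊗ₘ γ))
  linarith
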